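/- Let $K\ge 2$ and let $\mathsf P$ be the set of non-empty subsets of the receiver set $[1:K]$. In the $K$-user combination network, the input $X$ has one component $V_S\in\mathcal V_S$ for each $S\in\mathsf P$, where $\mathcal V_S$ is a finite alphabet with $|\mathcal V_S|=2^{C_S}$, and receiver $i$ noiselessly receives exactly the components $V_S$ with $i\in S$, that is, $Y_i=(V_S)_{S\in\mathsf P,\, i\in S}$; the network is used as a (noiseless) discrete memoryless broadcast channel. For $i\in[1:K]$ put $\overline{i}=[1:K]\setminus\{i\}$ and $\mathsf W_i=\{S\in\mathsf P: i\in S\}$; for $\mathsf W\subseteq\mathsf P$ put $C_{\mathsf W}=\sum_{S\in\mathsf W}C_S$; and for $\mathsf Q_1,\mathsf Q_2\subseteq\mathsf P$ let $\downarrow_{\mathsf Q_2}\mathsf Q_1=\{S\in\mathsf Q_2: S\subseteq T\text{ for some }T\in\mathsf Q_1\}$. Let $S_p=\{1,\dots,K-2\}$ (empty if $K=2$). Two independent messages $M_{\overline{K}}$ and $M_{\overline{K-1}}$, uniformly distributed on $\lceil 2^{nR_{\overline{K}}}\rceil$ and $\lceil 2^{nR_{\overline{K-1}}}\rceil$ values,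 are sent in $n$ channel uses; $M_{\overline{K}}$ must be decoded by all receivers except $K$, and $M_{\overline{K-1}}$ by all receivers except $K-1$. A pair of non-negative rates $(R_{\overline{K}},R_{\overline{K-1}})$ is achievable if there is a sequence of codes, one for each block length $n$, for which the probability that some receiver fails to decode a message intended for it tends to $0$ as $n\to\infty$; the capacity region is the closure of the set of achievable rate pairs. **Theorem.** The capacity region of the $K$-user combination network with the two messages $M_{\overline{K}}$, $M_{\overline{K-1}}$ is the set of pairs $(R_{\overline{K}},R_{\overline{K-1}})$ of non-negative real numbers satisfying $$ \begin{aligned} R_{\overline{K-1}} &\le C_{\mathsf W_K},\\ R_{\overline{K}} &\le C_{\mathsf W_{K-1}},\\ R_{\overline{K-1}}+R_{\overline{K}} &\le C_{\mathsf W_j} && \text{for all } j\in S_p,\\ R_{\overline{K-1}}+R_{\overline{K}} &\le C_{\downarrow_{\mathsf W_{K-1}}\{\overline{K}\}}+C_{\mathsf W_K},\\ 2R_{\overline{K-1}}+2R_{\overline{K}} &\le C_{\downarrow_{\mathsf W_j}\{\overline{K-1},\overline{K}\}}+C_{\mathsf W_K}+C_{\mathsf W_{K-1}} && \text{for all } j\in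 S_p. \end{aligned} $$ Moreover, the fourth inequality is equivalent to $R_{\overline{K-1}}+R_{\overline{K}}\le C_{\downarrow_{\mathsf W_K}\{\overline{K-1}\}}+C_{\mathsf W_{K-1}}$. -/

import Mathlib

open Filter Topology

namespace CombinationNetwork

/-! ### Message indices, up/down-sets -/

/-- The ground set `P`: the non-empty subsets of the set of receivers. Receivers `1, …, K` are the
elements of `Fin K` (receiver `i` is the element with value `i - 1`). The order is inclusion. -/
abbrev Idx (K : ℕ) : Type := {S : Finset (Fin K) // S.Nonempty}

/-- `W_i^F`: the indices in `F` that contain receiver `i`. -/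
def containing {K : ℕ} (i : Fin K) (F : Finset (Idx K)) : Finset (Idx K) :=
  F.filter (fun S => i ∈ S.1)

/-- `↓_{Q₂} Q₁ = (↓_P Q₁) ∩ Q₂`: the members of `Q₂` that are contained in some member of `Q₁`. -/
def downIn {K : ℕ} (Q₂ Q₁ : Finset (Idx K)) : Finset (Idx K) :=
  Q₂.filter (fun S => ∃ T ∈ Q₁, S.1 ⊆ T.1)

/-- The modular function `C_W = ∑_{S ∈ W} C_S`. -/
def capSum {K : ℕ} (C : Idx K → ℝ) (W : Finset (Idx K)) : ℝ := ∑ S ∈ W, C S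

/-! ### Discrete memoryless broadcast channels -/

/-- A discrete memoryless broadcast channel with `K` receivers, finite input alphabet `X` and finite
output alphabets `Y k`: `prob x y` is the probability `W(y₁, …, y_K | x)`. -/
structure DMBC (K : ℕ) (X : Type*) (Y : Fin K → Type*) [∀ k, Fintype (Y k)] where
  prob : X → (∀ k, Y k) → ℝ
  prob_nonneg : ∀ x y, 0 ≤ prob x y
  prob_sum : ∀ x, ∑ y, prob x y = 1

/-- A block code of length `n` for the messages `M_S`, `S ∈ E`, where `M_S` takes `size S` values.
The decoder of receiver `k` outputs an estimate of `M_S` for each `S ∈ E` with `k ∈ S`. -/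
structure Code {K : ℕ} (X : Type*) (Y : Fin K → Type*) (E : Finset (Idx K)) (size : E → ℕ)
    (n : ℕ) where
  enc : (∀ S : E, Fin (size S)) → (Fin n → X)
  dec : ∀ k : Fin K, (Fin n → Y k) → ∀ S : E, k ∈ S.1.1 → Fin (size S)

section Region

variable {K : ℕ} {X : Type*} {Y : Fin K → Type*} [∀ k, Fintype (Y k)]

/-- On message tuple `m` and output block `y`, some receiver decodes some message intended for it
incorrectly. -/
def Code.Errs {E : Finset (Idx K)} {size : E → ℕ} {n : ℕ} (c : Code X Y E size n)
    (m : ∀ S : E, Fin (size S)) (y : Fin n → ∀ k, Y k) : Prop :=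
  ∃ (k : Fin K) (S : E) (h : k ∈ S.1.1), c.dec k (fun t => y t k) S h ≠ m S

open Classical in
/-- The probability of error: the messages are independent and uniformly distributed, and the
channel is used `n` times without memory. -/
noncomputable def Code.errorProb {E : Finset (Idx K)} {size : E → ℕ} {n : ℕ}
    (c : Code X Y E size n) (ch : DMBC K X Y) : ℝ :=
  (∑ m : ∀ S : E, Fin (size S), ∑ y : Fin n → ∀ k, Y k,
      if c.Errs m y then ∏ t, ch.prob (c.enc m t) (y t) else 0)
    / (Fintype.card (∀ S : E, Fin (size S)) : ℝ)

/-- The number of values of a message of rate `r` at block length `n`, i.e. `2^{nr}` rounded up. -/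
noncomputable def messageSize (n : ℕ) (r : ℝ) : ℕ := ⌈(2 : ℝ) ^ ((n : ℝ) * r)⌉₊

/-- A tuple of (non-negative) rates is achievable if there is a sequence of codes with these rates
whose error probability tends to zero. -/
def Achievable (ch : DMBC K X Y) (E : Finset (Idx K)) (R : E → ℝ) : Prop :=
  (∀ S, 0 ≤ R S) ∧
  ∃ c : ∀ n : ℕ, Code X Y E (fun S => messageSize n (R S)) n,
    Tendsto (fun n => (c n).errorProb ch) atTop (𝓝 0)

/-- The capacity region: the closure of the set of achievable rate tuples. -/
def capacityRegion (ch : DMBC K X Y) (E : Finset (Idx K)) : Set (E → ℝ) :=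
  closure {R | Achievable ch E R}

end Region

/-! ### The combination network -/

/-- The input of the combination network: one component `V_S` for each `S ∈ P`. -/
abbrev Input {K : ℕ} (V : Idx K → Type*) : Type _ := ∀ S : Idx K, V S

/-- The output of receiver `k`: the components `V_S` with `S ∈ W_k^P`. -/
abbrev Output {K : ℕ} (V : Idx K → Type*) (k : Fin K) : Type _ :=
  ∀ S : {S : Idx K // S ∈ containing k Finset.univ}, V S.1

/-- What receiver `k` sees of the input `x`: it receives the components `V_S` with `k ∈ S`. -/
def received {K : ℕ} {V : Idx K → Type*} (x : Input V) (k : Fin K) : Output V k :=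
  fun S => x S.1

open Classical in
/-- The combination network as a broadcast channel: the component `V_S` of the input is received
noiselessly by the receivers in `S`, and not received by the others. -/
noncomputable def network {K : ℕ} (V : Idx K → Type*) [∀ S, Fintype (V S)] :
    DMBC K (Input V) (Output V) where
  prob x y := if y = received x then 1 else 0
  prob_nonneg x y := by split_ifs <;> norm_num
  prob_sum x := by simp

/-! ### The two messages, each intended for all receivers but one -/

/-- Receiver `K`. -/
def rxLast {K : ℕ} (hK : 2 ≤ K) : Fin K := ⟨K - 1, by omega⟩

/-- Receiver `K - 1`. -/
def rxPrev {K : ℕ} (hK : 2 ≤ K) : Fin K := ⟨K - 2, by omega⟩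

/-- The index `ī`: the set of all receivers but `i`. -/
def allBut {K : ℕ} (hK : 2 ≤ K) (i : Fin K) : Idx K :=
  ⟨{i}ᶜ, by
    rw [← Finset.card_pos, Finset.card_compl, Finset.card_singleton, Fintype.card_fin]
    omega⟩

/-- The message index set consisting of all receivers but `K`, and all receivers but `K - 1`. -/
def twoMsgs {K : ℕ} (hK : 2 ≤ K) : Finset (Idx K) :=
  {allBut hK (rxLast hK), allBut hK (rxPrev hK)}

/-- The index of the message for all receivers but `K`, as a member of the message index set. -/
def msgNotLast {K : ℕ} (hK : 2 ≤ K) : twoMsgs hK :=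
  ⟨allBut hK (rxLast hK), by simp [twoMsgs]⟩

/-- The index of the message for all receivers but `K - 1`, as a member of the message index set. -/
def msgNotPrev {K : ℕ} (hK : 2 ≤ K) : twoMsgs hK :=
  ⟨allBut hK (rxPrev hK), by simp [twoMsgs]⟩

end CombinationNetwork

open CombinationNetwork

/-!
Since the network is noiseless, a code with error probability at most `1/2` decodes at least half of
all message tuples correctly at every receiver, and on these tuples everything that a receiver of a
message sees determines the message. Counting what is sent on a set of components therefore bounds
sums of rates. The bounds on twice the sum of the rates come from submodularity: receivers `K` and
`K - 1` together know both messages, and what they both see, together with the components of `W_j`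
that one of the two does not see, includes everything that receiver `j` sees.

For achievability, each message is split into a private part, decoded by its own receivers only, and
a common part, decoded by all receivers. A component `S` carries a random function of all parts that
every receiver in `S` decodes. By the union bound such a code works as soon as, for each receiver
`k` and `Q ⊆ W_k`, the parts indexed by `Q` have total rate at most `C_{↓_{W_k} Q}`. If `σ` is the
sum of the two rates, the message that receiver `i` does not need gets the smallest private rate
that receiver `i` tolerates, `max 0 (σ - C_{W_i})`.
-/

namespace CombinationNetwork

open Finset

section Counting

theorem sum_card_image_fiber_le {M A D : Type*} [Fintype A] [DecidableEq A] [DecidableEq D]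
    (G : Finset M) {u : M → A} {d : M → D}
    (hu : ∀ m ∈ G, ∀ m' ∈ G, u m = u m' → d m = d m') :
    ∑ x ∈ G.image d, #({m ∈ G | d m = x}.image u) ≤ Fintype.card A := by
  rw [← card_biUnion]
  · exact card_le_univ _
  · intro x _ y _ hxy
    refine Finset.disjoint_left.2 fun a ha ha' => hxy ?_
    simp only [mem_image, mem_filter] at ha ha'
    obtain ⟨m, ⟨hm, rfl⟩, rfl⟩ := ha
    obtain ⟨m', ⟨hm', rfl⟩, h⟩ := ha'
    exact hu m hm m' hm' h.symm

/-- The counting form of the submodularity of entropy, `H(u, v) + H(d) ≤ H(u) + H(v)` for a common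
function `d` of `u` and `v`, combined with `H(d, w) ≤ H(d) + H(w)`. -/
theorem card_sq_le_of_common_function {M A B J D : Type*} [Fintype A] [Fintype B] [Fintype J]
    (G : Finset M) {u : M → A} {v : M → B} {w : M → J} {d : M → D}
    (hu : ∀ m ∈ G, ∀ m' ∈ G, u m = u m' → d m = d m')
    (hv : ∀ m ∈ G, ∀ m' ∈ G, v m = v m' → d m = d m')
    (huv : Set.InjOn (fun m => (u m, v m)) G) (hdw : Set.InjOn (fun m => (d m, w m)) G) :
    #G ^ 2 ≤ Fintype.card J * Fintype.card A * Fintype.card B := by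
  classical
  let fiber (x : D) : Finset M := {m ∈ G | d m = x}
  have hfiber : ∀ x, (fiber x : Set M) ⊆ G := fun x => coe_subset.2 (filter_subset _ _)
  have fiber_le_image (x : D) : #(fiber x) ≤ #((fiber x).image u) * #((fiber x).image v) := by
    rw [← card_product]
    exact card_le_card_of_injOn _
      (fun m hm => mk_mem_product (mem_image_of_mem u hm) (mem_image_of_mem v hm))
      (huv.mono (hfiber x))
  have fiber_le_card (x : D) : #(fiber x) ≤ Fintype.card J := by
    refine card_le_card_of_injOn w (t := univ) (by simp) fun m hm m' hm' h => ?_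
    refine hdw (hfiber x hm) (hfiber x hm') (Prod.ext ?_ h)
    exact (mem_filter.1 hm).2.trans (mem_filter.1 hm').2.symm
  calc #G ^ 2 = (∑ x ∈ G.image d, #(fiber x)) ^ 2 := by rw [card_eq_sum_card_image d G]
    _ ≤ (∑ x ∈ G.image d, Fintype.card J * #((fiber x).image u)) *
          ∑ x ∈ G.image d, #((fiber x).image v) :=
        sum_sq_le_sum_mul_sum_of_sq_le_mul _ (fun _ _ => Nat.zero_le _) (fun _ _ => Nat.zero_le _)
          fun x _ => by
            rw [sq, mul_assoc]
            exact Nat.mul_le_mul (fiber_le_card x) (fiber_le_image x)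
    _ ≤ Fintype.card J * Fintype.card A * Fintype.card B := by
        rw [← mul_sum]
        exact Nat.mul_le_mul (Nat.mul_le_mul_left _ (sum_card_image_fiber_le G hu))
          (sum_card_image_fiber_le G hv)

theorem card_eval_eq_mul_card {A B : Type*} [Fintype A] [DecidableEq A] [Fintype B]
    [DecidableEq B] {a a' : A} (h : a ≠ a') :
    #{f : A → B | f a = f a'} * Fintype.card B = Fintype.card (A → B) := by
  rw [← card_univ (α := B), ← card_product, ← card_univ (α := A → B)]
  refine card_nbij' (fun p => Function.update p.1 a' p.2)
    (fun g => (Function.update g a' (g a), g a')) (by simp) ?_ ?_ (fun g _ => by simp)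
  · intro g _
    simp [Function.update_of_ne h]
  · rintro ⟨f, b⟩ hf
    have hf' : f a = f a' := by simpa using hf
    simp [Function.update_of_ne h, hf']

end Counting

section Exponents

theorem le_of_eventually_rpow_le {a b c : ℝ}
    (h : ∀ᶠ n : ℕ in atTop, (2 : ℝ) ^ (n * a) ≤ c * (2 : ℝ) ^ (n * b)) : a ≤ b := by
  by_contra! hab
  have hgrow : Tendsto (fun n : ℕ => ((2 : ℝ) ^ (a - b)) ^ n) atTop atTop :=
    tendsto_pow_atTop_atTop_of_one_lt (Real.one_lt_rpow one_lt_two (sub_pos.2 hab))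
  obtain ⟨n, hle, hlt⟩ := (h.and (hgrow.eventually_gt_atTop c)).exists
  have hsplit : (2 : ℝ) ^ (n * a) = ((2 : ℝ) ^ (a - b)) ^ n * (2 : ℝ) ^ (n * b) := by
    rw [← Real.rpow_natCast, ← Real.rpow_mul zero_le_two, ← Real.rpow_add two_pos]
    ring_nf
  rw [hsplit] at hle
  exact hlt.not_ge (le_of_mul_le_mul_right hle (by positivity))

theorem messageSize_pos (n : ℕ) (r : ℝ) : 0 < messageSize n r :=
  Nat.ceil_pos.2 (by positivity)

theorem rpow_sum_le_prod_messageSize {ι : Type*} (n : ℕ) (r : ι → ℝ) (A : Finset ι) :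
    (2 : ℝ) ^ (n * ∑ i ∈ A, r i) ≤ ∏ i ∈ A, (messageSize n (r i) : ℝ) := by
  rw [mul_sum, Real.rpow_sum_of_pos two_pos]
  exact prod_le_prod (fun _ _ => by positivity) fun _ _ => Nat.le_ceil _

theorem messageSize_sub_one_le (n : ℕ) (r : ℝ) :
    ((messageSize n r - 1 : ℕ) : ℝ) ≤ (2 : ℝ) ^ (n * r) := by
  rw [Nat.cast_pred (messageSize_pos n r), sub_le_iff_le_add]
  exact (Nat.ceil_lt_add_one (by positivity)).le

end Exponents

section Capacities

variable {K : ℕ} {V : Idx K → Type*} [∀ S, Fintype (V S)] {C : Idx K → ℝ}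

theorem mem_containing_univ {k : Fin K} {S : Idx K} : S ∈ containing k univ ↔ k ∈ S.1 := by
  simp [containing]

theorem prod_card_block (hC : ∀ S, (Fintype.card (V S) : ℝ) = (2 : ℝ) ^ C S) (n : ℕ)
    (W : Finset (Idx K)) :
    ∏ S ∈ W, (Fintype.card (Fin n → V S) : ℝ) = (2 : ℝ) ^ (n * capSum C W) := by
  rw [capSum, mul_comm, Real.rpow_mul_natCast zero_le_two, Real.rpow_sum_of_pos two_pos,
    ← prod_pow]
  exact prod_congr rfl fun S _ => by simp [hC]

theorem nonempty_of_card_eq_rpow (hC : ∀ S, (Fintype.card (V S) : ℝ) = (2 : ℝ) ^ C S)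
    (S : Idx K) : Nonempty (V S) := by
  rw [← Fintype.card_pos_iff, ← Nat.cast_pos (α := ℝ), hC]
  positivity

theorem nonneg_of_card_eq_rpow (hC : ∀ S, (Fintype.card (V S) : ℝ) = (2 : ℝ) ^ C S)
    (S : Idx K) : 0 ≤ C S := by
  have := nonempty_of_card_eq_rpow hC S
  have hone : (1 : ℝ) ≤ 2 ^ C S := by
    rw [← hC]
    exact_mod_cast Fintype.card_pos (α := V S)
  contrapose! hone
  exact Real.rpow_lt_one_of_one_lt_of_neg one_lt_two hone

theorem capSum_mono (hC : ∀ S, 0 ≤ C S) {W W' : Finset (Idx K)} (hW : W ⊆ W') :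
    capSum C W ≤ capSum C W' :=
  sum_le_sum_of_subset_of_nonneg hW fun S _ _ => hC S

theorem capSum_downIn_singleton_add (C : Idx K → ℝ) (W : Finset (Idx K)) (S : Idx K) :
    capSum C (downIn W {S}) + capSum C (univ.filter fun T => ¬ T.1 ⊆ S.1) =
      capSum C (W ∪ univ.filter fun T => ¬ T.1 ⊆ S.1) := by
  rw [capSum, capSum, capSum, ← sum_union]
  · congr 1
    ext T
    simp only [downIn, mem_union, mem_filter, mem_univ, true_and, mem_singleton, exists_eq_left]
    tauto
  · simp +contextual [Finset.disjoint_left, downIn]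

theorem downIn_mono (W : Finset (Idx K)) {Q Q' : Finset (Idx K)} (hQ : Q ⊆ Q') :
    downIn W Q ⊆ downIn W Q' :=
  monotone_filter_right W fun _ _ ⟨T, hT, hST⟩ => ⟨T, hQ hT, hST⟩

end Capacities

section CorrectMessages

variable {K : ℕ} {V : Idx K → Type*} {E : Finset (Idx K)} {size : E → ℕ} {n : ℕ}

open Classical in
/-- The message tuples that all receivers decode correctly over the combination network, which has
no noise. -/
noncomputable def Code.goodSet (c : Code (Input V) (Output V) E size n) :
    Finset (∀ S : E, Fin (size S)) :=
  {m | ¬ c.Errs m fun t => received (c.enc m t)}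

theorem Code.mem_goodSet {c : Code (Input V) (Output V) E size n} {m : ∀ S : E, Fin (size S)} :
    m ∈ c.goodSet ↔ ∀ (k : Fin K) (S : E) (hk : k ∈ S.1.1),
      c.dec k (fun t => received (c.enc m t) k) S hk = m S := by
  simp [Code.goodSet, Code.Errs]

variable [∀ S, Fintype (V S)]

theorem Code.errorProb_network (c : Code (Input V) (Output V) E size n) :
    c.errorProb (network V) = #c.goodSetᶜ / (Fintype.card (∀ S : E, Fin (size S)) : ℝ) := by
  classical
  have output_sum (m : ∀ S : E, Fin (size S)) : (∑ y : Fin n → ∀ k, Output V k,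
      if c.Errs m y then ∏ t, (network V).prob (c.enc m t) (y t) else 0) =
        if c.Errs m (fun t => received (c.enc m t)) then (1 : ℝ) else 0 := by
    rw [sum_eq_single fun t => received (c.enc m t)]
    · simp [network]
    · intro y _ hy
      obtain ⟨t, ht⟩ := Function.ne_iff.1 hy
      rw [prod_eq_zero (mem_univ t) (by simp [network, ht]), ite_self]
    · simp
  have goodSet_compl : c.goodSetᶜ = univ.filter fun m =>
      c.Errs m fun t => received (c.enc m t) := by
    ext m
    simp [Code.goodSet]
  rw [goodSet_compl, ← sum_boole, Code.errorProb]
  congr 1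
  exact sum_congr rfl fun m _ => by rw [← output_sum m]

end CorrectMessages

/-! ### Converse -/

section Converse

variable {K : ℕ} {V : Idx K → Type*} {C : Idx K → ℝ} {E : Finset (Idx K)} {size : E → ℕ} {n : ℕ}

/-- The part of the codeword of `m` that is sent on the components in `W`. -/
def Code.view (c : Code (Input V) (Output V) E size n) (W : Finset (Idx K))
    (m : ∀ S : E, Fin (size S)) : ∀ S : W, Fin n → V S.1 :=
  fun S t => c.enc m t S

/-- The components in `W` include everything that some receiver of the message `M_T` sees, so that
`M_T` can be decoded from them. -/
def Reveals (W : Finset (Idx K)) (T : Idx K) : Prop :=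
  ∃ k ∈ T.1, containing k univ ⊆ W

theorem Code.view_eq_iff (c : Code (Input V) (Output V) E size n) {W : Finset (Idx K)}
    {m m' : ∀ S : E, Fin (size S)} :
    c.view W m = c.view W m' ↔ ∀ S ∈ W, ∀ t, c.enc m t S = c.enc m' t S := by
  simp [funext_iff, Code.view]

theorem Code.eq_of_view_eq (c : Code (Input V) (Output V) E size n)
    {m m' : ∀ S : E, Fin (size S)} (hm : m ∈ c.goodSet) (hm' : m' ∈ c.goodSet)
    {W : Finset (Idx K)} {S : E} (hW : Reveals W S.1) (h : c.view W m = c.view W m') :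
    m S = m' S := by
  obtain ⟨k, hk, hkW⟩ := hW
  rw [← Code.mem_goodSet.1 hm k S hk, ← Code.mem_goodSet.1 hm' k S hk]
  congr 1
  funext t T
  exact c.view_eq_iff.1 h T (hkW T.2) t

variable [∀ S, Fintype (V S)]

theorem Code.prod_size_le_two_mul_card_goodSet (c : Code (Input V) (Output V) E size n)
    (hc : c.errorProb (network V) ≤ 1 / 2) : ∏ S, (size S : ℝ) ≤ 2 * #c.goodSet := by
  have hcard : (Fintype.card (∀ S : E, Fin (size S)) : ℝ) = ∏ S, (size S : ℝ) := by simp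
  have hsum : (#c.goodSetᶜ : ℝ) + #c.goodSet = ∏ S, (size S : ℝ) := by
    rw [← hcard]
    exact_mod_cast card_compl_add_card c.goodSet
  rw [c.errorProb_network, hcard] at hc
  rcases (prod_nonneg fun S _ => Nat.cast_nonneg (size S) : (0 : ℝ) ≤ ∏ S, (size S : ℝ)).eq_or_lt
    with hzero | hpos
  · rw [← hzero]
    positivity
  · rw [div_le_iff₀ hpos] at hc
    linarith

theorem card_view (hC : ∀ S, (Fintype.card (V S) : ℝ) = (2 : ℝ) ^ C S) (n : ℕ)
    (W : Finset (Idx K)) :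
    (Fintype.card (∀ S : W, Fin n → V S.1) : ℝ) = (2 : ℝ) ^ (n * capSum C W) := by
  rw [← prod_card_block hC, Fintype.card_pi, Nat.cast_prod,
    prod_coe_sort W fun S => (Fintype.card (Fin n → V S) : ℝ)]

/-- Given the other messages, what is sent on `W` determines the messages in `A`. -/
theorem Code.prod_size_le (hC : ∀ S, (Fintype.card (V S) : ℝ) = (2 : ℝ) ^ C S)
    (c : Code (Input V) (Output V) E size n) (hc : c.errorProb (network V) ≤ 1 / 2)
    (hsize : ∀ S, 0 < size S) {W : Finset (Idx K)} {A : Finset E}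
    (hA : ∀ S ∈ A, Reveals W S.1) :
    ∏ S ∈ A, (size S : ℝ) ≤ 2 * (2 : ℝ) ^ (n * capSum C W) := by
  have hinj : Set.InjOn (fun m => (c.view W m, Aᶜ.restrict m)) c.goodSet := by
    intro m hm m' hm' h
    funext S
    by_cases hS : S ∈ A
    · exact c.eq_of_view_eq hm hm' (hA S hS) (congrArg Prod.fst h)
    · exact congrFun (congrArg Prod.snd h) ⟨S, mem_compl.2 hS⟩
  have hgood : (#c.goodSet : ℝ) ≤ (2 : ℝ) ^ (n * capSum C W) * ∏ S ∈ Aᶜ, (size S : ℝ) := by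
    have hrest : Fintype.card (∀ S : (Aᶜ : Finset E), Fin (size S)) = ∏ S ∈ Aᶜ, size S := by
      simp only [Fintype.card_pi, Fintype.card_fin, prod_coe_sort Aᶜ size]
    rw [← card_view hC, ← Nat.cast_prod, ← hrest, ← Nat.cast_mul, ← Fintype.card_prod,
      Nat.cast_le, ← card_univ]
    exact card_le_card_of_injOn _ (by simp) hinj
  refine le_of_mul_le_mul_right (a := ∏ S ∈ Aᶜ, (size S : ℝ)) ?_
    (prod_pos fun S _ => Nat.cast_pos.2 (hsize S))
  calc (∏ S ∈ A, (size S : ℝ)) * ∏ S ∈ Aᶜ, (size S : ℝ) = ∏ S, (size S : ℝ) :=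
        prod_mul_prod_compl A _
    _ ≤ 2 * #c.goodSet := c.prod_size_le_two_mul_card_goodSet hc
    _ ≤ 2 * (2 : ℝ) ^ (n * capSum C W) * ∏ S ∈ Aᶜ, (size S : ℝ) := by
        rw [mul_assoc]
        gcongr

theorem Code.sq_prod_size_le (hC : ∀ S, (Fintype.card (V S) : ℝ) = (2 : ℝ) ^ C S)
    (c : Code (Input V) (Output V) E size n) (hc : c.errorProb (network V) ≤ 1 / 2)
    {J W₁ W₂ : Finset (Idx K)} (hW : ∀ S : E, Reveals W₁ S.1 ∨ Reveals W₂ S.1)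
    (hJ : ∀ S : E, Reveals (J ∪ W₁ ∩ W₂) S.1) :
    (∏ S, (size S : ℝ)) ^ 2 ≤
      4 * (2 : ℝ) ^ (n * (capSum C J + capSum C W₁ + capSum C W₂)) := by
  have hcount : #c.goodSet ^ 2 ≤ Fintype.card (∀ S : J, Fin n → V S.1) *
      Fintype.card (∀ S : W₁, Fin n → V S.1) * Fintype.card (∀ S : W₂, Fin n → V S.1) := by
    refine card_sq_le_of_common_function c.goodSet (u := c.view W₁) (v := c.view W₂)
      (w := c.view J) (d := c.view (W₁ ∩ W₂)) ?_ ?_ ?_ ?_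
    · exact fun m _ m' _ h => c.view_eq_iff.2 fun S hS =>
        c.view_eq_iff.1 h S (mem_of_mem_inter_left hS)
    · exact fun m _ m' _ h => c.view_eq_iff.2 fun S hS =>
        c.view_eq_iff.1 h S (mem_of_mem_inter_right hS)
    · intro m hm m' hm' h
      obtain ⟨h₁, h₂⟩ := Prod.ext_iff.1 h
      exact funext fun S => (hW S).elim (c.eq_of_view_eq hm hm' · h₁)
        (c.eq_of_view_eq hm hm' · h₂)
    · intro m hm m' hm' h
      obtain ⟨h₁₂, hJ'⟩ := Prod.ext_iff.1 h
      refine funext fun S => c.eq_of_view_eq hm hm' (hJ S) (c.view_eq_iff.2 fun T hT => ?_)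
      exact (mem_union.1 hT).elim (c.view_eq_iff.1 hJ' T) (c.view_eq_iff.1 h₁₂ T)
  calc (∏ S, (size S : ℝ)) ^ 2 ≤ (2 * #c.goodSet) ^ 2 := by
        gcongr
        exact c.prod_size_le_two_mul_card_goodSet hc
    _ = 4 * (#c.goodSet : ℝ) ^ 2 := by ring
    _ ≤ 4 * ((2 : ℝ) ^ (n * capSum C J) * (2 : ℝ) ^ (n * capSum C W₁) *
          (2 : ℝ) ^ (n * capSum C W₂)) := by
        rw [← card_view hC, ← card_view hC, ← card_view hC]
        gcongr
        exact_mod_cast hcount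
    _ = 4 * (2 : ℝ) ^ (n * (capSum C J + capSum C W₁ + capSum C W₂)) := by
        rw [← Real.rpow_add two_pos, ← Real.rpow_add two_pos, mul_add, mul_add]

theorem nonneg_of_mem_capacityRegion {R : E → ℝ} (hR : R ∈ capacityRegion (network V) E) (S : E) :
    0 ≤ R S :=
  closure_minimal (t := {R : E → ℝ | 0 ≤ R S}) (fun _ h => h.1 S)
    (isClosed_le continuous_const (by fun_prop)) hR

theorem sum_le_capSum_of_mem_capacityRegion
    (hC : ∀ S, (Fintype.card (V S) : ℝ) = (2 : ℝ) ^ C S) {R : E → ℝ}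
    (hR : R ∈ capacityRegion (network V) E) {W : Finset (Idx K)} {A : Finset E}
    (hA : ∀ S ∈ A, Reveals W S.1) : ∑ S ∈ A, R S ≤ capSum C W := by
  refine closure_minimal (t := {R : E → ℝ | ∑ S ∈ A, R S ≤ capSum C W}) ?_
    (isClosed_le (by fun_prop) continuous_const) hR
  rintro R ⟨-, c, hc⟩
  refine le_of_eventually_rpow_le (c := 2) ?_
  filter_upwards [hc.eventually_le_const one_half_pos] with n hn
  exact (rpow_sum_le_prod_messageSize n R A).trans
    ((c n).prod_size_le hC hn (fun _ => messageSize_pos n _) hA)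

theorem two_mul_sum_le_capSum_of_mem_capacityRegion
    (hC : ∀ S, (Fintype.card (V S) : ℝ) = (2 : ℝ) ^ C S) {R : E → ℝ}
    (hR : R ∈ capacityRegion (network V) E) {J W₁ W₂ : Finset (Idx K)}
    (hW : ∀ S : E, Reveals W₁ S.1 ∨ Reveals W₂ S.1)
    (hJ : ∀ S : E, Reveals (J ∪ W₁ ∩ W₂) S.1) :
    2 * ∑ S, R S ≤ capSum C J + capSum C W₁ + capSum C W₂ := by
  refine closure_minimal (t := {R : E → ℝ | 2 * ∑ S, R S ≤ _}) ?_
    (isClosed_le (by fun_prop) continuous_const) hR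
  rintro R ⟨-, c, hc⟩
  refine le_of_eventually_rpow_le (c := 4) ?_
  filter_upwards [hc.eventually_le_const one_half_pos] with n hn
  calc (2 : ℝ) ^ (n * (2 * ∑ S, R S)) = ((2 : ℝ) ^ (n * ∑ S, R S)) ^ 2 := by
        rw [← Real.rpow_mul_natCast zero_le_two]
        ring_nf
    _ ≤ (∏ S, (messageSize n (R S) : ℝ)) ^ 2 := by
        gcongr
        exact rpow_sum_le_prod_messageSize n R univ
    _ ≤ _ := (c n).sq_prod_size_le hC hn hW hJ

end Converse

/-! ### Random coding -/

section RandomCoding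

variable {K : ℕ} {V : Idx K → Type*} {C : Idx K → ℝ} {ι : Type*} {α : ι → Type*} {ρ : ι → Idx K}
  {n : ℕ} [Fintype ι]

/-- The message parts that are carried by component `S`, when part `i` has to be decoded by the
receivers in `ρ i` and is superposed on all components that only these receivers see. -/
def partsOn (ρ : ι → Idx K) (S : Idx K) : Finset ι := {i | S.1 ⊆ (ρ i).1}

/-- The message parts that receiver `k` has to decode. -/
def decodedParts (ρ : ι → Idx K) (k : Fin K) : Finset ι := {i | k ∈ (ρ i).1}

theorem partsOn_subset_decodedParts {S : Idx K} {k : Fin K} (hk : k ∈ S.1) :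
    partsOn ρ S ⊆ decodedParts ρ k := fun i hi => by
  simp only [partsOn, decodedParts, mem_filter_univ] at hi ⊢
  exact hi hk

/-- The message parts in which two tuples differ. -/
def diffSet [∀ i, DecidableEq (α i)] (m m' : ∀ i, α i) : Finset ι := {i | m i ≠ m' i}

theorem restrict_eq_iff_disjoint_diffSet [∀ i, DecidableEq (α i)] (s : Finset ι) (m m' : ∀ i, α i) :
    s.restrict m = s.restrict m' ↔ Disjoint s (diffSet m m') := by
  simp [Finset.disjoint_left, funext_iff, diffSet]

theorem card_diffSet_eq [DecidableEq ι] [∀ i, DecidableEq (α i)] [∀ i, Fintype (α i)]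
    (m : ∀ i, α i) (D : Finset ι) :
    #{m' | diffSet m m' = D} = ∏ i ∈ D, (Fintype.card (α i) - 1) := by
  have hpi : ({m' | diffSet m m' = D} : Finset (∀ i, α i)) =
      Fintype.piFinset fun i => if i ∈ D then {m i}ᶜ else {m i} := by
    ext m'
    simp only [mem_filter_univ, Fintype.mem_piFinset, Finset.ext_iff, diffSet]
    refine forall_congr' fun i => ?_
    split_ifs with hi <;> simp [hi, eq_comm]
  rw [hpi, Fintype.card_piFinset, ← prod_subset (subset_univ D)]
  · exact prod_congr rfl fun i hi => by rw [if_pos hi, card_compl, card_singleton]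
  · intro i _ hi
    rw [if_neg hi, card_singleton]

/-- A superposition codebook: the block sent on component `S` is an arbitrary function of the
message parts carried by `S`. -/
abbrev Codebook (V : Idx K → Type*) (ρ : ι → Idx K) (α : ι → Type*) (n : ℕ) : Type _ :=
  ∀ S : Idx K, (∀ i : partsOn ρ S, α i) → Fin n → V S

/-- The codeword of the tuple `m` of message parts. -/
def Codebook.codeword (F : Codebook V ρ α n) (m : ∀ i, α i) (t : Fin n) : Input V :=
  fun S => F S ((partsOn ρ S).restrict m) t

/-- Receiver `k` sees the same output for `m` and `m'`. -/
def Codebook.Collides (F : Codebook V ρ α n) (k : Fin K) (m m' : ∀ i, α i) : Prop :=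
  ∀ S : Idx K, k ∈ S.1 → F S ((partsOn ρ S).restrict m) = F S ((partsOn ρ S).restrict m')

/-- Some receiver cannot decode its parts of `m`, because it sees the same output for a tuple with
different values of these parts. -/
def Codebook.Ambiguous (F : Codebook V ρ α n) (m : ∀ i, α i) : Prop :=
  ∃ k, ∃ i ∈ decodedParts ρ k, ∃ m', m i ≠ m' i ∧ F.Collides k m m'

theorem Codebook.collides_iff (F : Codebook V ρ α n) {k : Fin K} {m m' : ∀ i, α i} :
    F.Collides k m m' ↔
      ∀ t, received (F.codeword m t) k = received (F.codeword m' t) k := by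
  constructor
  · exact fun h t => funext fun S => congrFun (h S (mem_containing_univ.1 S.2)) t
  · exact fun h S hS => funext fun t => congrFun (h t) ⟨S, mem_containing_univ.2 hS⟩

theorem Codebook.Ambiguous.exists_diffSet_subset [∀ i, DecidableEq (α i)] {F : Codebook V ρ α n}
    {m : ∀ i, α i} (h : F.Ambiguous m) :
    ∃ k m', F.Collides k m m' ∧ diffSet m m' ⊆ decodedParts ρ k ∧ (diffSet m m').Nonempty := by
  classical
  obtain ⟨k, i, hi, m', hne, hcol⟩ := h
  refine ⟨k, (decodedParts ρ k).piecewise m' m, fun S hS => ?_, fun i' hi' => ?_, i, ?_⟩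
  · rw [hcol S hS]
    congr 1
    funext i'
    exact ((decodedParts ρ k).piecewise_eq_of_mem _ _ (partsOn_subset_decodedParts hS i'.2)).symm
  · by_contra hc
    simp [diffSet, hc] at hi'
  · simpa [diffSet, hi] using hne

variable [∀ i, Fintype (α i)] [∀ S, Fintype (V S)]

open Classical in
theorem card_collides_le [∀ i, DecidableEq (α i)]
    (hC : ∀ S, (Fintype.card (V S) : ℝ) = (2 : ℝ) ^ C S) (k : Fin K) (m m' : ∀ i, α i) :
    (#{F : Codebook V ρ α n | F.Collides k m m'} : ℝ) ≤ Fintype.card (Codebook V ρ α n) *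
      (2 : ℝ) ^ (-(n * capSum C (downIn (containing k univ) ((diffSet m m').image ρ)))) := by
  set W := downIn (containing k univ) ((diffSet m m').image ρ)
  have mem_W (S : Idx K) : S ∈ W ↔
      k ∈ S.1 ∧ (partsOn ρ S).restrict m ≠ (partsOn ρ S).restrict m' := by
    rw [Ne, restrict_eq_iff_disjoint_diffSet, disjoint_comm, not_disjoint_iff]
    simp only [W, downIn, mem_filter, mem_containing_univ, exists_mem_image, partsOn, mem_univ,
      true_and]
  have hpi : ({F : Codebook V ρ α n | F.Collides k m m'} : Finset _) = Fintype.piFinset fun S =>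
      {f | k ∈ S.1 → f ((partsOn ρ S).restrict m) = f ((partsOn ρ S).restrict m')} := by
    ext F
    rw [mem_filter_univ, Fintype.mem_piFinset]
    exact forall_congr' fun S => by rw [mem_filter_univ]
  rw [Real.rpow_neg zero_le_two, ← prod_card_block hC, ← prod_inv_distrib, ← univ_inter W,
    ← prod_ite_mem, hpi, Fintype.card_piFinset, Fintype.card_pi, Nat.cast_prod, Nat.cast_prod,
    ← prod_mul_distrib]
  refine prod_le_prod (fun _ _ => Nat.cast_nonneg _) fun S _ => ?_
  split_ifs with hS
  · obtain ⟨hk, hne⟩ := (mem_W S).1 hS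
    have := nonempty_of_card_eq_rpow hC S
    rw [le_mul_inv_iff₀ (by exact_mod_cast Fintype.card_pos)]
    simp only [hk, true_imp_iff]
    exact_mod_cast (card_eval_eq_mul_card hne).le
  · rw [mul_one]
    exact_mod_cast card_le_univ _

/-- The union bound on the error probability of random superposition codebooks, when part `i` takes
`N i` values: the sum runs over the receivers `k` and the sets `D` of parts that receiver `k` may
decode incorrectly. -/
noncomputable def unionBound (C : Idx K → ℝ) (ρ : ι → Idx K) (N : ι → ℕ) (n : ℕ) : ℝ :=
  ∑ k, ∑ D ∈ (decodedParts ρ k).powerset with D.Nonempty,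
    (∏ i ∈ D, ((N i - 1 : ℕ) : ℝ)) *
      (2 : ℝ) ^ (-(n * capSum C (downIn (containing k univ) (D.image ρ))))

open Classical in
theorem card_ambiguous_le (hC : ∀ S, (Fintype.card (V S) : ℝ) = (2 : ℝ) ^ C S) (m : ∀ i, α i) :
    (#{F : Codebook V ρ α n | F.Ambiguous m} : ℝ) ≤
      Fintype.card (Codebook V ρ α n) * unionBound C ρ (fun i => Fintype.card (α i)) n := by
  have hsub : ({F : Codebook V ρ α n | F.Ambiguous m} : Finset _) ⊆ univ.biUnion fun k =>
      {D ∈ (decodedParts ρ k).powerset | D.Nonempty}.biUnion fun D =>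
        (univ.filter fun m' => diffSet m m' = D).biUnion fun m' => {F | F.Collides k m m'} := by
    intro F hF
    obtain ⟨k, m', hcol, hD, hne⟩ := (mem_filter.1 hF).2.exists_diffSet_subset
    simp only [mem_biUnion, mem_filter, mem_univ, true_and, mem_powerset]
    exact ⟨k, diffSet m m', ⟨hD, hne⟩, m', rfl, hcol⟩
  have hcount : #{F : Codebook V ρ α n | F.Ambiguous m} ≤
      ∑ k, ∑ D ∈ (decodedParts ρ k).powerset with D.Nonempty, ∑ m' with diffSet m m' = D,
        #{F : Codebook V ρ α n | F.Collides k m m'} :=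
    (card_le_card hsub).trans <| card_biUnion_le.trans <|
      sum_le_sum fun k _ => card_biUnion_le.trans <| sum_le_sum fun D _ => card_biUnion_le
  refine (Nat.cast_le.2 hcount).trans ?_
  simp only [unionBound, mul_sum, Nat.cast_sum]
  refine sum_le_sum fun k _ => sum_le_sum fun D _ => ?_
  calc ∑ m' with diffSet m m' = D, (#{F : Codebook V ρ α n | F.Collides k m m'} : ℝ)
      ≤ ∑ m' with diffSet m m' = D, Fintype.card (Codebook V ρ α n) *
          (2 : ℝ) ^ (-(n * capSum C (downIn (containing k univ) (D.image ρ)))) := by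
        refine sum_le_sum fun m' hm' => ?_
        rw [← (mem_filter.1 hm').2]
        exact card_collides_le hC k m m'
    _ = Fintype.card (Codebook V ρ α n) * ((∏ i ∈ D, ((Fintype.card (α i) - 1 : ℕ) : ℝ)) *
          (2 : ℝ) ^ (-(n * capSum C (downIn (containing k univ) (D.image ρ))))) := by
        rw [sum_const, card_diffSet_eq, nsmul_eq_mul, Nat.cast_prod]
        ring

open Classical in
theorem exists_codebook (hC : ∀ S, (Fintype.card (V S) : ℝ) = (2 : ℝ) ^ C S) {M : Type*}
    [Fintype M] (e : M → ∀ i, α i) : ∃ F : Codebook V ρ α n,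
      (#{m | F.Ambiguous (e m)} : ℝ) ≤
        Fintype.card M * unionBound C ρ (fun i => Fintype.card (α i)) n := by
  have := nonempty_of_card_eq_rpow hC
  obtain ⟨F, -, hF⟩ := exists_le_of_sum_le (univ_nonempty (α := Codebook V ρ α n))
    (f := fun F => (#{m | F.Ambiguous (e m)} : ℝ))
    (g := fun _ => Fintype.card M * unionBound C ρ (fun i => Fintype.card (α i)) n) <| calc
      ∑ F : Codebook V ρ α n, (#{m | F.Ambiguous (e m)} : ℝ)
        = ∑ m, (#{F : Codebook V ρ α n | F.Ambiguous (e m)} : ℝ) := by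
          simp only [← sum_boole]
          exact sum_comm
      _ ≤ ∑ _m : M, Fintype.card (Codebook V ρ α n) *
            unionBound C ρ (fun i => Fintype.card (α i)) n :=
          sum_le_sum fun m _ => card_ambiguous_le hC (e m)
      _ = ∑ _F : Codebook V ρ α n,
            Fintype.card M * unionBound C ρ (fun i => Fintype.card (α i)) n := by
          simp only [sum_const, card_univ, nsmul_eq_mul]
          ring
  exact ⟨F, hF⟩

end RandomCoding

section Achievability

variable {K : ℕ} {V : Idx K → Type*} {C : Idx K → ℝ} {E : Finset (Idx K)} {size : E → ℕ} {n : ℕ}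

/-- The code with a given encoder whose receivers output the messages they decode from an arbitrary
message tuple that explains what they received. -/
noncomputable def Code.ofEncoder [∀ S, NeZero (size S)]
    (enc : (∀ S : E, Fin (size S)) → Fin n → Input V) : Code (Input V) (Output V) E size n where
  enc := enc
  dec k y S _ := Function.invFun (fun m t => received (enc m t) k) y S

theorem Code.mem_goodSet_ofEncoder [∀ S, NeZero (size S)]
    {enc : (∀ S : E, Fin (size S)) → Fin n → Input V} {m : ∀ S : E, Fin (size S)}
    (h : ∀ (k : Fin K) (S : E), k ∈ S.1.1 → ∀ m',
      (∀ t, received (enc m t) k = received (enc m' t) k) → m S = m' S) :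
    m ∈ (Code.ofEncoder enc).goodSet := by
  refine Code.mem_goodSet.2 fun k S hk => (h k S hk _ fun t => ?_).symm
  exact (congrFun (Function.invFun_eq (f := fun m t => received (enc m t) k) ⟨m, rfl⟩) t).symm

variable [∀ S, Fintype (V S)] {ι : Type*} [Fintype ι] {ρ : ι → Idx K} {src : ι → E}

theorem exists_code_of_parts (hC : ∀ S, (Fintype.card (V S) : ℝ) = (2 : ℝ) ^ C S)
    [∀ S, NeZero (size S)] (hρ : ∀ i, (src i).1.1 ⊆ (ρ i).1) {N : ι → ℕ}
    (hN : ∀ S, size S ≤ ∏ i with src i = S, N i) :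
    ∃ c : Code (Input V) (Output V) E size n, c.errorProb (network V) ≤ unionBound C ρ N n := by
  classical
  have exists_split (S : E) : Nonempty (Fin (size S) ↪ ∀ i : {i // src i = S}, Fin (N i)) := by
    refine Function.Embedding.nonempty_of_card_le ((Fintype.card_fin _).trans_le (hN S)
      |>.trans_eq ?_)
    simp only [Fintype.card_pi, Fintype.card_fin]
    exact prod_subtype _ (by simp) _
  let split (S : E) := (exists_split S).some
  let parts (m : ∀ S : E, Fin (size S)) (i : ι) : Fin (N i) := split (src i) (m (src i)) ⟨i, rfl⟩
  obtain ⟨F, hF⟩ := exists_codebook (n := n) (ρ := ρ) hC parts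
  simp only [Fintype.card_fin] at hF
  let c : Code (Input V) (Output V) E size n := Code.ofEncoder fun m => F.codeword (parts m)
  have mem_goodSet (m) (hm : ¬ F.Ambiguous (parts m)) : m ∈ c.goodSet := by
    refine Code.mem_goodSet_ofEncoder fun k S hk m' hy => ?_
    by_contra hne
    obtain ⟨⟨i, rfl⟩, hi⟩ := Function.ne_iff.1 ((split S).injective.ne hne)
    exact hm ⟨k, i, (mem_filter_univ i).2 (hρ i hk), parts m', hi, F.collides_iff.2 hy⟩
  have card_compl_le : #c.goodSetᶜ ≤ #{m | F.Ambiguous (parts m)} := by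
    refine card_le_card fun m hm => (mem_filter_univ m).2 ?_
    by_contra hm'
    exact mem_compl.1 hm (mem_goodSet m hm')
  refine ⟨c, ?_⟩
  rw [c.errorProb_network, div_le_iff₀' (by exact_mod_cast Fintype.card_pos)]
  exact (Nat.cast_le.2 card_compl_le).trans hF

theorem tendsto_unionBound {r : ι → ℝ} (hr : ∀ i, 0 ≤ r i)
    (hcond : ∀ k, ∀ Q ⊆ containing k univ,
      ∑ i with ρ i ∈ Q, r i ≤ capSum C (downIn (containing k univ) Q)) {θ : ℝ} (hθ : θ < 1) :
    Tendsto (fun n => unionBound C ρ (fun i => messageSize n (θ * r i)) n) atTop (𝓝 0) := by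
  rw [← sum_const_zero (s := univ (α := Fin K))]
  refine tendsto_finsetSum _ fun k _ => ?_
  rw [← sum_const_zero (s := (decodedParts ρ k).powerset.filter Finset.Nonempty)]
  refine tendsto_finsetSum _ fun D hD => ?_
  obtain ⟨hDk, hDne⟩ := mem_filter.1 hD
  set cap := capSum C (downIn (containing k univ) (D.image ρ))
  have sum_le_cap : ∑ i ∈ D, r i ≤ cap := by
    refine (sum_le_sum_of_subset_of_nonneg (fun i hi => ?_) fun i _ _ => hr i).trans
      (hcond k _ (image_subset_iff.2 fun i hi => ?_))
    · exact (mem_filter_univ i).2 (mem_image_of_mem ρ hi)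
    · exact mem_containing_univ.2 ((mem_filter_univ i).1 (mem_powerset.1 hDk hi))
  by_cases hzero : ∃ i ∈ D, r i = 0
  · obtain ⟨i, hi, hri⟩ := hzero
    refine tendsto_const_nhds.congr fun n => ?_
    rw [prod_eq_zero hi (by simp [hri, messageSize]), zero_mul]
  · push Not at hzero
    have sum_pos : 0 < ∑ i ∈ D, r i := sum_pos (fun i hi => (hr i).lt_of_ne' (hzero i hi)) hDne
    have exponent_neg : θ * ∑ i ∈ D, r i - cap < 0 :=
      sub_neg.2 ((mul_lt_of_lt_one_left sum_pos hθ).trans_le sum_le_cap)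
    refine squeeze_zero (fun n => by positivity) (fun n => ?_)
      (tendsto_pow_atTop_nhds_zero_of_lt_one (by positivity)
        (Real.rpow_lt_one_of_one_lt_of_neg one_lt_two exponent_neg))
    calc (∏ i ∈ D, ((messageSize n (θ * r i) - 1 : ℕ) : ℝ)) * (2 : ℝ) ^ (-(n * cap))
        ≤ (∏ i ∈ D, (2 : ℝ) ^ (n * (θ * r i))) * (2 : ℝ) ^ (-(n * cap)) := by
          gcongr with i
          exact messageSize_sub_one_le n _
      _ = ((2 : ℝ) ^ (θ * ∑ i ∈ D, r i - cap)) ^ n := by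
          rw [← Real.rpow_sum_of_pos two_pos, ← Real.rpow_add two_pos, ← Real.rpow_mul_natCast
            zero_le_two, ← mul_sum, ← mul_sum]
          ring_nf

theorem achievable_of_split (hC : ∀ S, (Fintype.card (V S) : ℝ) = (2 : ℝ) ^ C S)
    (hρ : ∀ i, (src i).1.1 ⊆ (ρ i).1) {r : ι → ℝ} (hr : ∀ i, 0 ≤ r i)
    (hcond : ∀ k, ∀ Q ⊆ containing k univ,
      ∑ i with ρ i ∈ Q, r i ≤ capSum C (downIn (containing k univ) Q))
    {θ : ℝ} (hθ₀ : 0 ≤ θ) (hθ₁ : θ < 1) :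
    Achievable (network V) E (fun S => θ * ∑ i with src i = S, r i) := by
  have exists_code (n : ℕ) : ∃ c : Code (Input V) (Output V) E
      (fun S => messageSize n (θ * ∑ i with src i = S, r i)) n,
      c.errorProb (network V) ≤ unionBound C ρ (fun i => messageSize n (θ * r i)) n := by
    have (S : E) : NeZero (messageSize n (θ * ∑ i with src i = S, r i)) :=
      ⟨(messageSize_pos n _).ne'⟩
    refine exists_code_of_parts hC hρ fun S => Nat.ceil_le.2 ?_
    rw [mul_sum, Nat.cast_prod]
    exact rpow_sum_le_prod_messageSize n _ _
  choose c hc using exists_code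
  refine ⟨fun S => mul_nonneg hθ₀ (sum_nonneg fun i _ => hr i), c,
    squeeze_zero (fun n => ?_) hc (tendsto_unionBound hr hcond hθ₁)⟩
  rw [Code.errorProb_network]
  positivity

theorem mem_capacityRegion_of_split (hC : ∀ S, (Fintype.card (V S) : ℝ) = (2 : ℝ) ^ C S)
    (hρ : ∀ i, (src i).1.1 ⊆ (ρ i).1) {r : ι → ℝ} (hr : ∀ i, 0 ≤ r i)
    (hcond : ∀ k, ∀ Q ⊆ containing k univ,
      ∑ i with ρ i ∈ Q, r i ≤ capSum C (downIn (containing k univ) Q)) :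
    (fun S => ∑ i with src i = S, r i) ∈ capacityRegion (network V) E := by
  have hcont : Continuous fun (θ : ℝ) (S : E) => θ * ∑ i with src i = S, r i := by fun_prop
  have hlim : Tendsto (fun (θ : ℝ) (S : E) => θ * ∑ i with src i = S, r i) (𝓝[<] 1)
      (𝓝 fun S => ∑ i with src i = S, r i) := by
    simpa using (hcont.tendsto 1).mono_left nhdsWithin_le_nhds
  refine mem_closure_of_tendsto hlim ?_
  filter_upwards [Ioo_mem_nhdsLT (zero_lt_one (α := ℝ))] with θ hθ
  exact achievable_of_split hC hρ hr hcond hθ.1.le hθ.2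

/-- Rate splitting: the private part of `M_S`, of rate `p S`, is decoded by the receivers of `M_S`
only, and the common part, of rate `q S`, by all receivers. -/
theorem mem_capacityRegion_of_private_common [NeZero K]
    (hC : ∀ S, (Fintype.card (V S) : ℝ) = (2 : ℝ) ^ C S) {p q : E → ℝ} (hp : ∀ S, 0 ≤ p S)
    (hq : ∀ S, 0 ≤ q S)
    (hcommon : ∀ k, ∑ S with k ∈ S.1.1, p S + ∑ S, q S ≤ capSum C (containing k univ))
    (hprivate : ∀ k, ∀ Q ⊆ containing k univ,
      ∑ S with S.1 ∈ Q, p S ≤ capSum C (downIn (containing k univ) Q)) :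
    (fun S => p S + q S) ∈ capacityRegion (network V) E := by
  let all : Idx K := ⟨univ, univ_nonempty⟩
  have hmem := mem_capacityRegion_of_split (src := Sum.elim (id : E → E) id)
    (ρ := Sum.elim (fun S => S.1) fun _ => all) (r := Sum.elim p q) hC (by simp [all])
    (by simp [hp, hq]) fun k Q hQ => ?_
  · convert hmem using 2 with S
    rw [sum_filter, Fintype.sum_sum_type]
    exact congrArg₂ _ (Fintype.sum_ite_eq' S p).symm (Fintype.sum_ite_eq' S q).symm
  · have hsplit : ∑ i with Sum.elim (fun S : E => S.1) (fun _ => all) i ∈ Q, Sum.elim p q i =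
        ∑ S with S.1 ∈ Q, p S + if all ∈ Q then ∑ S, q S else 0 := by
      rw [sum_filter, sum_filter, Fintype.sum_sum_type]
      refine congrArg (_ + ·) ?_
      by_cases hall : all ∈ Q <;> simp [hall]
    rw [hsplit]
    split_ifs with hall
    · have hdown : downIn (containing k univ) Q = containing k univ :=
        filter_true_of_mem fun S _ => ⟨all, hall, subset_univ _⟩
      rw [hdown]
      refine le_trans (add_le_add_left (sum_le_sum_of_subset_of_nonneg ?_ fun S _ _ => hp S) _)
        (hcommon k)
      exact monotone_filter_right univ fun S _ hS => mem_containing_univ.1 (hQ hS)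
    · rw [add_zero]
      exact hprivate k Q hQ

end Achievability

/-! ### Two messages -/

section TwoMessages

variable {K : ℕ} {hK : 2 ≤ K} {V : Idx K → Type*} [∀ S, Fintype (V S)] {C : Idx K → ℝ}

theorem rxLast_ne_rxPrev : rxLast hK ≠ rxPrev hK := by
  simp only [rxLast, rxPrev, ne_eq, Fin.mk.injEq]
  omega

theorem lt_sub_two_iff (hK : 2 ≤ K) {k : Fin K} :
    k.val < K - 2 ↔ k ≠ rxPrev hK ∧ k ≠ rxLast hK := by
  simp only [rxLast, rxPrev, ne_eq, Fin.ext_iff]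
  omega

theorem mem_allBut (hK : 2 ≤ K) {i k : Fin K} : k ∈ (allBut hK i).1 ↔ k ≠ i := by
  simp [allBut]

theorem subset_allBut {i : Fin K} {S : Finset (Fin K)} : S ⊆ (allBut hK i).1 ↔ i ∉ S := by
  simp [allBut, subset_compl_singleton]

theorem filter_not_subset_allBut (i : Fin K) :
    (univ.filter fun T : Idx K => ¬ T.1 ⊆ (allBut hK i).1) = containing i univ := by
  simp only [subset_allBut, not_not, containing]

theorem capSum_downIn_allBut_add (C : Idx K → ℝ) (k i : Fin K) :
    capSum C (downIn (containing k univ) {allBut hK i}) + capSum C (containing i univ) =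
      capSum C (containing k univ ∪ containing i univ) := by
  simpa only [filter_not_subset_allBut] using
    capSum_downIn_singleton_add C (containing k univ) (allBut hK i)

theorem prev_mem_msgNotLast : rxPrev hK ∈ (msgNotLast hK).1.1 :=
  (mem_allBut hK).2 rxLast_ne_rxPrev.symm

theorem last_mem_msgNotPrev : rxLast hK ∈ (msgNotPrev hK).1.1 :=
  (mem_allBut hK).2 rxLast_ne_rxPrev

theorem msgNotPrev_ne_msgNotLast : msgNotPrev hK ≠ msgNotLast hK := fun h =>
  (mem_allBut hK).1 (h ▸ last_mem_msgNotPrev) rfl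

theorem univ_twoMsgs : (univ : Finset (twoMsgs hK)) = {msgNotPrev hK, msgNotLast hK} := by
  refine (eq_univ_of_forall fun ⟨S, hS⟩ => ?_).symm
  rw [twoMsgs, mem_insert, mem_singleton] at hS
  rcases hS with rfl | rfl
  exacts [mem_insert_of_mem (mem_singleton_self _), mem_insert_self _ _]

theorem sum_twoMsgs (f : twoMsgs hK → ℝ) : ∑ S, f S = f (msgNotPrev hK) + f (msgNotLast hK) := by
  rw [univ_twoMsgs, sum_pair msgNotPrev_ne_msgNotLast]

theorem forall_twoMsgs {P : twoMsgs hK → Prop} :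
    (∀ S, P S) ↔ P (msgNotPrev hK) ∧ P (msgNotLast hK) := by
  have hcases (S : twoMsgs hK) : S = msgNotPrev hK ∨ S = msgNotLast hK := by
    simpa only [univ_twoMsgs, mem_insert, mem_singleton] using mem_univ S
  refine ⟨fun h => ⟨h _, h _⟩, fun h S => ?_⟩
  rcases hcases S with rfl | rfl
  exacts [h.1, h.2]

theorem exists_eq_allBut (hK : 2 ≤ K) {k : Fin K} (hk : ¬ k.val < K - 2) :
    ∃ S : twoMsgs hK, S.1 = allBut hK k := by
  rw [lt_sub_two_iff hK, not_and_or, not_not, not_not] at hk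
  rcases hk with rfl | rfl
  exacts [⟨msgNotPrev hK, rfl⟩, ⟨msgNotLast hK, rfl⟩]

theorem mem_of_lt_sub_two {k : Fin K} (hk : k.val < K - 2) (S : twoMsgs hK) : k ∈ S.1.1 := by
  obtain ⟨hprev, hlast⟩ := (lt_sub_two_iff hK).1 hk
  exact forall_twoMsgs (P := fun S => k ∈ S.1.1).2
    ⟨(mem_allBut hK).2 hprev, (mem_allBut hK).2 hlast⟩ S

/-- The inequalities that describe the capacity region of the network with the two messages. -/
structure RateBounds (hK : 2 ≤ K) (C : Idx K → ℝ) (R : twoMsgs hK → ℝ) : Prop where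
  prev_nonneg : 0 ≤ R (msgNotPrev hK)
  last_nonneg : 0 ≤ R (msgNotLast hK)
  prev_le : R (msgNotPrev hK) ≤ capSum C (containing (rxLast hK) univ)
  last_le : R (msgNotLast hK) ≤ capSum C (containing (rxPrev hK) univ)
  sum_le : ∀ j : Fin K, j.val < K - 2 →
    R (msgNotPrev hK) + R (msgNotLast hK) ≤ capSum C (containing j univ)
  sum_le_add : R (msgNotPrev hK) + R (msgNotLast hK) ≤
    capSum C (downIn (containing (rxPrev hK) univ) {allBut hK (rxLast hK)}) +
      capSum C (containing (rxLast hK) univ)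
  two_mul_sum_le : ∀ j : Fin K, j.val < K - 2 →
    2 * R (msgNotPrev hK) + 2 * R (msgNotLast hK) ≤
      capSum C (downIn (containing j univ) {allBut hK (rxPrev hK), allBut hK (rxLast hK)}) +
        capSum C (containing (rxLast hK) univ) + capSum C (containing (rxPrev hK) univ)

theorem containing_subset_downIn_union_inter (k i j : Fin K) :
    containing k univ ⊆ downIn (containing k univ) {allBut hK i, allBut hK j} ∪
      containing j univ ∩ containing i univ := fun S hS => by
  simp only [downIn, mem_union, mem_inter, mem_filter, mem_containing_univ, mem_insert,
    mem_singleton, exists_eq_or_imp, exists_eq_left, subset_allBut] at hS ⊢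
  tauto

theorem rateBounds_of_mem_capacityRegion
    (hC : ∀ S, (Fintype.card (V S) : ℝ) = (2 : ℝ) ^ C S) {R : twoMsgs hK → ℝ}
    (hR : R ∈ capacityRegion (network V) (twoMsgs hK)) : RateBounds hK C R := by
  have single_le {S : twoMsgs hK} {k : Fin K} (hk : k ∈ S.1.1) :
      R S ≤ capSum C (containing k univ) := by
    simpa using sum_le_capSum_of_mem_capacityRegion hC hR (A := {S})
      fun T hT => mem_singleton.1 hT ▸ ⟨k, hk, Subset.rfl⟩
  have total_le {W : Finset (Idx K)} (hW : ∀ S : twoMsgs hK, Reveals W S.1) :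
      R (msgNotPrev hK) + R (msgNotLast hK) ≤ capSum C W := by
    simpa only [sum_twoMsgs] using
      sum_le_capSum_of_mem_capacityRegion hC hR (A := univ) fun S _ => hW S
  refine ⟨nonneg_of_mem_capacityRegion hR _, nonneg_of_mem_capacityRegion hR _,
    single_le last_mem_msgNotPrev, single_le prev_mem_msgNotLast,
    fun j hj => total_le fun S => ⟨j, mem_of_lt_sub_two hj S, Subset.rfl⟩, ?_, fun j hj => ?_⟩
  · rw [capSum_downIn_allBut_add]
    exact total_le (forall_twoMsgs.2
      ⟨⟨_, last_mem_msgNotPrev, subset_union_right⟩, ⟨_, prev_mem_msgNotLast, subset_union_left⟩⟩)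
  · rw [← mul_add, ← sum_twoMsgs]
    refine two_mul_sum_le_capSum_of_mem_capacityRegion hC hR ?_ fun S =>
      ⟨j, mem_of_lt_sub_two hj S, containing_subset_downIn_union_inter j (rxPrev hK) (rxLast hK)⟩
    exact forall_twoMsgs.2
      ⟨.inl ⟨_, last_mem_msgNotPrev, Subset.rfl⟩, .inr ⟨_, prev_mem_msgNotLast, Subset.rfl⟩⟩

/-- The rate of the private part of the message `M_S` when the sum of all rates is `σ`. A receiver
outside `S` decodes everything but this part and sees only components that are not contained in `S`,
so the private part has to carry the excess of `σ` over their total capacity. -/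
noncomputable def privateRate (C : Idx K → ℝ) (σ : ℝ) (S : Idx K) : ℝ :=
  max 0 (σ - capSum C (univ.filter fun T => ¬ T.1 ⊆ S.1))

theorem privateRate_allBut (hK : 2 ≤ K) (σ : ℝ) (i : Fin K) :
    privateRate C σ (allBut hK i) = max 0 (σ - capSum C (containing i univ)) := by
  rw [privateRate, filter_not_subset_allBut]

theorem privateRate_le_capSum_downIn (hC : ∀ S, 0 ≤ C S) {σ : ℝ} {W : Finset (Idx K)} {S : Idx K}
    (hσ : σ ≤ capSum C (W ∪ univ.filter fun T => ¬ T.1 ⊆ S.1)) :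
    privateRate C σ S ≤ capSum C (downIn W {S}) := by
  rw [← capSum_downIn_singleton_add] at hσ
  exact max_le (sum_nonneg fun T _ => hC T) (sub_le_iff_le_add.2 hσ)

namespace RateBounds

variable {R : twoMsgs hK → ℝ}

theorem sum_le_capSum_union (h : RateBounds hK C R) (hC : ∀ S, 0 ≤ C S) {k : Fin K}
    {S : twoMsgs hK} (hk : k ∈ S.1.1) :
    ∑ T, R T ≤ capSum C (containing k univ ∪ univ.filter fun T => ¬ T.1 ⊆ S.1.1) := by
  rw [sum_twoMsgs]
  have hbound := h.sum_le_add
  rw [capSum_downIn_allBut_add] at hbound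
  by_cases hlt : k.val < K - 2
  · exact (h.sum_le k hlt).trans (capSum_mono hC subset_union_left)
  have hk_eq : k = rxPrev hK ∨ k = rxLast hK := by
    simpa only [lt_sub_two_iff hK, not_and_or, not_not] using hlt
  obtain ⟨_, hS⟩ := S
  rcases mem_insert.1 hS with rfl | hS
  · obtain rfl := hk_eq.resolve_right ((mem_allBut hK).1 hk)
    rwa [filter_not_subset_allBut]
  · obtain rfl := mem_singleton.1 hS
    obtain rfl := hk_eq.resolve_left ((mem_allBut hK).1 hk)
    rwa [filter_not_subset_allBut, union_comm]

theorem privateRate_le (h : RateBounds hK C R) (hC : ∀ S, 0 ≤ C S) {k : Fin K} {S : twoMsgs hK}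
    (hk : k ∈ S.1.1) :
    privateRate C (∑ T, R T) S.1 ≤ capSum C (downIn (containing k univ) {S.1}) :=
  privateRate_le_capSum_downIn hC (h.sum_le_capSum_union hC hk)

theorem privateRate_add_le (h : RateBounds hK C R) (hC : ∀ S, 0 ≤ C S) {k : Fin K}
    (hk : k.val < K - 2) :
    privateRate C (∑ T, R T) (msgNotPrev hK).1 + privateRate C (∑ T, R T) (msgNotLast hK).1 ≤
      capSum C (downIn (containing k univ) {(msgNotPrev hK).1, (msgNotLast hK).1}) := by
  set Q : Finset (Idx K) := {(msgNotPrev hK).1, (msgNotLast hK).1}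
  have le_down (S : twoMsgs hK) (hS : {S.1} ⊆ Q) :
      privateRate C (∑ T, R T) S.1 ≤ capSum C (downIn (containing k univ) Q) :=
    (h.privateRate_le hC (mem_of_lt_sub_two hk S)).trans (capSum_mono hC (downIn_mono _ hS))
  have eq_zero_or (i : Fin K) : privateRate C (∑ T, R T) (allBut hK i) = 0 ∨
      privateRate C (∑ T, R T) (allBut hK i) = ∑ T, R T - capSum C (containing i univ) := by
    rw [privateRate_allBut]
    exact max_choice _ _
  rcases eq_zero_or (rxPrev hK) with hprev | hprev
  · exact (add_eq_right.2 hprev).trans_le (le_down _ (by simp [Q]))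
  rcases eq_zero_or (rxLast hK) with hlast | hlast
  · exact (add_eq_left.2 hlast).trans_le (le_down _ (by simp [Q]))
  · refine (congrArg₂ _ hprev hlast).trans_le ?_
    have hsum : _ ≤ capSum C (downIn (containing k univ) Q) + _ + _ := h.two_mul_sum_le k hk
    rw [sum_twoMsgs]
    linarith

theorem privateRate_le_self (h : RateBounds hK C R) (S : twoMsgs hK) :
    privateRate C (∑ T, R T) S.1 ≤ R S := by
  revert S
  simp only [forall_twoMsgs, sum_twoMsgs]
  constructor
  · refine (privateRate_allBut hK _ _).trans_le (max_le h.prev_nonneg ?_)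
    linarith [h.last_le]
  · refine (privateRate_allBut hK _ _).trans_le (max_le h.last_nonneg ?_)
    linarith [h.prev_le]

theorem sum_privateRate_le (h : RateBounds hK C R) (hC : ∀ S, 0 ≤ C S) {k : Fin K}
    {Q : Finset (Idx K)} (hQ : Q ⊆ containing k univ) :
    ∑ S : twoMsgs hK with S.1 ∈ Q, privateRate C (∑ T, R T) S.1 ≤
      capSum C (downIn (containing k univ) Q) := by
  have le_down (S : twoMsgs hK) (hS : S.1 ∈ Q) :
      privateRate C (∑ T, R T) S.1 ≤ capSum C (downIn (containing k univ) Q) :=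
    (h.privateRate_le hC (mem_containing_univ.1 (hQ hS))).trans
      (capSum_mono hC (downIn_mono _ (singleton_subset_iff.2 hS)))
  rw [sum_filter, sum_twoMsgs]
  split_ifs with hprev hlast hlast
  · have hk : k.val < K - 2 := (lt_sub_two_iff hK).2
      ⟨(mem_allBut hK).1 (mem_containing_univ.1 (hQ hprev)),
        (mem_allBut hK).1 (mem_containing_univ.1 (hQ hlast))⟩
    exact (h.privateRate_add_le hC hk).trans
      (capSum_mono hC (downIn_mono _ (insert_subset hprev (singleton_subset_iff.2 hlast))))
  · simpa only [add_zero] using le_down _ hprev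
  · simpa only [zero_add] using le_down _ hlast
  · exact (add_zero 0).trans_le (sum_nonneg fun T _ => hC T)

theorem sum_privateRate_add_le (h : RateBounds hK C R) (k : Fin K) :
    ∑ S : twoMsgs hK with k ∈ S.1.1, privateRate C (∑ T, R T) S.1 +
      ∑ S, (R S - privateRate C (∑ T, R T) S.1) ≤ capSum C (containing k univ) := by
  have privateRate_nonneg (S : twoMsgs hK) : 0 ≤ privateRate C (∑ T, R T) S.1 := le_max_left _ _
  suffices ∑ T, R T - capSum C (containing k univ) ≤
      ∑ S : twoMsgs hK with k ∉ S.1.1, privateRate C (∑ T, R T) S.1 by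
    have hsplit := sum_filter_add_sum_filter_not univ (fun S : twoMsgs hK => k ∈ S.1.1)
      fun S => privateRate C (∑ T, R T) S.1
    rw [sum_sub_distrib]
    linarith
  by_cases hk : k.val < K - 2
  · refine (sub_nonpos.2 ?_).trans (sum_nonneg fun S _ => privateRate_nonneg S)
    rw [sum_twoMsgs]
    exact h.sum_le k hk
  · obtain ⟨S, hS⟩ := exists_eq_allBut hK hk
    have hkS : k ∉ S.1.1 := fun hkS => (mem_allBut hK).1 (hS ▸ hkS) rfl
    calc ∑ T, R T - capSum C (containing k univ) ≤ privateRate C (∑ T, R T) S.1 := by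
          rw [hS, privateRate_allBut]
          exact le_max_right _ _
      _ ≤ _ := single_le_sum (f := fun S : twoMsgs hK => privateRate C (∑ T, R T) S.1)
          (fun S _ => privateRate_nonneg S) ((mem_filter_univ S).2 hkS)

theorem mem_capacityRegion (h : RateBounds hK C R)
    (hC : ∀ S, (Fintype.card (V S) : ℝ) = (2 : ℝ) ^ C S) :
    R ∈ capacityRegion (network V) (twoMsgs hK) := by
  have : NeZero K := ⟨by omega⟩
  simpa only [add_sub_cancel] using
    mem_capacityRegion_of_private_common (p := fun S => privateRate C (∑ T, R T) S.1)
      (q := fun S => R S - privateRate C (∑ T, R T) S.1) hC (fun S => le_max_left _ _)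
      (fun S => sub_nonneg.2 (h.privateRate_le_self S)) h.sum_privateRate_add_le
      fun k Q hQ => h.sum_privateRate_le (nonneg_of_card_eq_rpow hC) hQ

end RateBounds

theorem mem_capacityRegion_iff_rateBounds (hC : ∀ S, (Fintype.card (V S) : ℝ) = (2 : ℝ) ^ C S)
    {R : twoMsgs hK → ℝ} : R ∈ capacityRegion (network V) (twoMsgs hK) ↔ RateBounds hK C R :=
  ⟨rateBounds_of_mem_capacityRegion hC, fun h => h.mem_capacityRegion hC⟩

end TwoMessages

end CombinationNetwork

theorem mainTheorem3 {K : ℕ} (hK : 2 ≤ K) (V : Idx K → Type*) [∀ S, Fintype (V S)]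
    (C : Idx K → ℝ) (hC : ∀ S, (Fintype.card (V S) : ℝ) = (2 : ℝ) ^ C S) :
    capacityRegion (network V) (twoMsgs hK) =
      {R : twoMsgs hK → ℝ |
        0 ≤ R (msgNotPrev hK) ∧ 0 ≤ R (msgNotLast hK) ∧
        R (msgNotPrev hK) ≤ capSum C (containing (rxLast hK) Finset.univ) ∧
        R (msgNotLast hK) ≤ capSum C (containing (rxPrev hK) Finset.univ) ∧
        (∀ j : Fin K, j.val < K - 2 →
          R (msgNotPrev hK) + R (msgNotLast hK) ≤ capSum C (containing j Finset.univ)) ∧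
        R (msgNotPrev hK) + R (msgNotLast hK) ≤
          capSum C (downIn (containing (rxPrev hK) Finset.univ) {allBut hK (rxLast hK)}) +
            capSum C (containing (rxLast hK) Finset.univ) ∧
        (∀ j : Fin K, j.val < K - 2 →
          2 * R (msgNotPrev hK) + 2 * R (msgNotLast hK) ≤
            capSum C (downIn (containing j Finset.univ)
              {allBut hK (rxPrev hK), allBut hK (rxLast hK)}) +
            capSum C (containing (rxLast hK) Finset.univ) +
            capSum C (containing (rxPrev hK) Finset.univ))} ∧
    (∀ R : twoMsgs hK → ℝ,
      R (msgNotPrev hK) + R (msgNotLast hK) ≤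
          capSum C (downIn (containing (rxPrev hK) Finset.univ) {allBut hK (rxLast hK)}) +
            capSum C (containing (rxLast hK) Finset.univ) ↔
      R (msgNotPrev hK) + R (msgNotLast hK) ≤
          capSum C (downIn (containing (rxLast hK) Finset.univ) {allBut hK (rxPrev hK)}) +
            capSum C (containing (rxPrev hK) Finset.univ)) := by
  refine ⟨Set.ext fun R => (mem_capacityRegion_iff_rateBounds hC).trans ?_, fun R => ?_⟩
  · constructor <;> exact fun ⟨prev_nonneg, last_nonneg, prev_le, last_le, sum_le, sum_le_add,
      two_mul_sum_le⟩ => ⟨prev_nonneg, last_nonneg, prev_le, last_le, sum_le, sum_le_add,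
      two_mul_sum_le⟩
  · rw [capSum_downIn_allBut_add, capSum_downIn_allBut_add, Finset.union_comm]
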